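/- **Conventions.** All 2-categories are weak (bicategories). For $1$-morphisms $X:r\to s$ and $Y:s\to t$ the composite is written $X\otimes Y:r\to t$; vertical composition of $2$-morphisms is written $\circ$ and horizontal composition $\otimes$; associators and unitors are suppressed. In a dagger 2-category, a $2$-morphism $f:X\to X$ is *positive* if $f=g^\dagger\circ g$ for some $2$-morphism $g:X\to X'$. A *$C^*$-2-category* is a $\mathbb C$-linear dagger 2-category whose spaces of $2$-morphisms are Banach spaces with $\|f\circ g\|\le\|f\|\,\|g\|$ and $\|f^\dagger\circ f\|=\|f\|^2$, and such that $f^\dagger\circ f$ is a positive element of the $C^*$-algebra $\mathrm{End}(X)$ for every $f:X\to Y$. It is *presemisimple* if every Hom-category is semisimple (it has a zero object and binary dagger direct sums, dagger idempotents split, and endomorphism algebras are finite-dimensional), there are a zero object and binary direct sums of objects, every $1$-morphism has a right dual, and every object is a finite direct sum of simple objects (objects $r$ with $\mathrm{End}(\mathrm{id}_r)\cong\mathbb C$). Let $\mathrm{Tr}_r:\mathrm{End}(\mathrm{id}_r)\to\mathbb C$ be the trace sending every minimal projection to $1$. A right dual $[X^*,\ \eta_X:\mathrm{id}_s\to X^*\otimes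 X,\ \epsilon_X:X\otimes X^*\to \mathrm{id}_r]$ of $X:r\to s$ is *standard* if for all $T\in\mathrm{End}(X)$ $$\mathrm{Tr}_s[\eta_X^\dagger\circ(\mathrm{id}_{X^*}\otimes T)\circ\eta_X]=\mathrm{Tr}_r[\epsilon_X\circ(T\otimes\mathrm{id}_{X^*})\circ\epsilon_X^\dagger].$$ $X$ is *separable* if, for a standard right dual, $\dim_L(X)=\eta_X^\dagger\circ\eta_X\in\mathrm{End}(\mathrm{id}_s)$ is invertible; then $n_X:=\sqrt{\dim_L(X)}$ (positive square root). A *separable standard Frobenius algebra* (SSFA) in $\mathrm{End}(r)$ is an algebra $[A,m,u]$ in the tensor category $\mathrm{End}(r)$ satisfying the Frobenius equations $(\mathrm{id}\otimes m)\circ(m^\dagger\otimes \mathrm{id})=m^\dagger\circ m=(m\otimes\mathrm{id})\circ(\mathrm{id}\otimes m^\dagger)$, with $m\circ m^\dagger=\mathrm{id}_A$, and for which the self-duality $[A,\ m^\dagger\circ u,\ u^\dagger\circ m]$ is standard. If $X:r\to s$ is separable with standard right dual $[X^*,\eta_X,\epsilon_X]$, then $X\otimes X^*$ carries the *pair of pants*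 SSFA structure $$m=\mathrm{id}_X\otimes(n_X^{-1}\circ\eta_X^\dagger)\otimes\mathrm{id}_{X^*},\qquad u=(\mathrm{id}_X\otimes n_X\otimes\mathrm{id}_{X^*})\circ\epsilon_X^\dagger .$$ For SSFAs $A,B$ in $\mathrm{End}(r)$, a morphism $f:A\to B$ is *CP* if $$(\mathrm{id}_A\otimes m_B)\circ(\mathrm{id}_A\otimes f\otimes\mathrm{id}_B)\circ(m_A^\dagger\otimes\mathrm{id}_B):A\otimes B\to A\otimes B$$ equals $g^\dagger\circ g$ for some object $S$ of $\mathrm{End}(r)$ and some $g:A\otimes B\to S$. A *unitary $*$-isomorphism* $f:A\to B$ is a unitary with $f\circ m_A=m_B\circ(f\otimes f)$, $f\circ u_A=u_B$ and $f^\dagger=(\mathrm{id}_A\otimes (u_B^\dagger\circ m_B))\circ(\mathrm{id}_A\otimes f\otimes\mathrm{id}_B)\circ((m_A^\dagger\circ u_A)\otimes\mathrm{id}_B)$. A presemisimple $C^*$-2-category is *semisimple* if, for every object $r$, every SSFA in $\mathrm{End}(r)$ is unitarily $*$-isomorphic to the pair of pants algebra $X\otimes X^*$ of some separable $1$-morphism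 $X:r\to s$. **Theorem (Covariant Choi theorem).** Let $\mathcal C$ be a semisimple $C^*$-2-category and let $r,s,t$ be objects. Let $X:r\to s$ and $Y:r\to t$ be separable $1$-morphisms with standard right duals $[X^*,\eta_X,\epsilon_X]$ and $[Y^*,\eta_Y,\epsilon_Y]$, and let $X\otimes X^*$ and $Y\otimes Y^*$ be the corresponding pair of pants SSFAs in $\mathrm{End}(r)$. Then the CP morphisms $f:X\otimes X^*\to Y\otimes Y^*$ form a convex cone, the positive elements of $\mathrm{End}(Y^*\otimes X)$ form a convex cone, and the wire-bending map $$f\ \longmapsto\ \tilde f:=(\eta_Y^\dagger\otimes\mathrm{id}_{Y^*}\otimes\mathrm{id}_X)\circ(\mathrm{id}_{Y^*}\otimes f\otimes\mathrm{id}_X)\circ(\mathrm{id}_{Y^*}\otimes\mathrm{id}_X\otimes\eta_X)$$ restricts to a bijection from the first cone onto the second which preserves linear combinations with non-negative coefficients, i.e. to an isomorphism of convex cones. -/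

import Mathlib

open CategoryTheory Bicategory

universe w v u

noncomputable section

namespace CStarTwo

/-- A C*-2-category: a `ℂ`-linear dagger bicategory whose spaces of 2-morphisms are Banach spaces
satisfying the C*-axioms.  For 1-morphisms `X : r ⟶ s`, `Y : s ⟶ t` the tensor product `X ⊗ Y` is
`X ≫ Y`; for 2-morphisms `g ∘ f` is `f ≫ g`; `id_X ⊗ f` is `X ◁ f` and `f ⊗ id_X` is `f ▷ X`. -/
class CStarBicategory (B : Type u) [Bicategory.{w, v} B] where
  /-- the dagger of a 2-morphism -/
  dag : ∀ {a b : B} {X Y : a ⟶ b}, (X ⟶ Y) → (Y ⟶ X)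
  dag_dag : ∀ {a b : B} {X Y : a ⟶ b} (f : X ⟶ Y), dag (dag f) = f
  dag_id : ∀ {a b : B} (X : a ⟶ b), dag (𝟙 X) = 𝟙 X
  dag_comp : ∀ {a b : B} {X Y Z : a ⟶ b} (f : X ⟶ Y) (g : Y ⟶ Z), dag (f ≫ g) = dag g ≫ dag f
  dag_whiskerLeft : ∀ {a b c : B} (W : a ⟶ b) {X Y : b ⟶ c} (f : X ⟶ Y),
    dag (W ◁ f) = W ◁ dag f
  dag_whiskerRight : ∀ {a b c : B} {X Y : a ⟶ b} (f : X ⟶ Y) (W : b ⟶ c),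
    dag (f ▷ W) = dag f ▷ W
  dag_associator : ∀ {a b c d : B} (X : a ⟶ b) (Y : b ⟶ c) (Z : c ⟶ d),
    dag (α_ X Y Z).hom = (α_ X Y Z).inv
  dag_leftUnitor : ∀ {a b : B} (X : a ⟶ b), dag (λ_ X).hom = (λ_ X).inv
  dag_rightUnitor : ∀ {a b : B} (X : a ⟶ b), dag (ρ_ X).hom = (ρ_ X).inv
  /-- the norm and the additive structure on 2-morphisms -/
  homNormedAddCommGroup : ∀ {a b : B} (X Y : a ⟶ b), NormedAddCommGroup (X ⟶ Y)
  /-- the complex vector space structure on 2-morphisms -/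
  homNormedSpace : ∀ {a b : B} (X Y : a ⟶ b), NormedSpace ℂ (X ⟶ Y)
  homComplete : ∀ {a b : B} (X Y : a ⟶ b), CompleteSpace (X ⟶ Y)
  add_comp : ∀ {a b : B} {X Y Z : a ⟶ b} (f g : X ⟶ Y) (h : Y ⟶ Z),
    (f + g) ≫ h = f ≫ h + g ≫ h
  comp_add : ∀ {a b : B} {X Y Z : a ⟶ b} (f : X ⟶ Y) (g h : Y ⟶ Z),
    f ≫ (g + h) = f ≫ g + f ≫ h
  smul_comp : ∀ {a b : B} {X Y Z : a ⟶ b} (c : ℂ) (f : X ⟶ Y) (g : Y ⟶ Z),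
    (c • f) ≫ g = c • (f ≫ g)
  comp_smul : ∀ {a b : B} {X Y Z : a ⟶ b} (f : X ⟶ Y) (c : ℂ) (g : Y ⟶ Z),
    f ≫ (c • g) = c • (f ≫ g)
  whiskerLeft_add : ∀ {a b c : B} (W : a ⟶ b) {X Y : b ⟶ c} (f g : X ⟶ Y),
    W ◁ (f + g) = W ◁ f + W ◁ g
  whiskerLeft_smul : ∀ {a b c : B} (W : a ⟶ b) {X Y : b ⟶ c} (z : ℂ) (f : X ⟶ Y),
    W ◁ (z • f) = z • (W ◁ f)
  add_whiskerRight : ∀ {a b c : B} {X Y : a ⟶ b} (f g : X ⟶ Y) (W : b ⟶ c),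
    (f + g) ▷ W = f ▷ W + g ▷ W
  smul_whiskerRight : ∀ {a b c : B} {X Y : a ⟶ b} (z : ℂ) (f : X ⟶ Y) (W : b ⟶ c),
    (z • f) ▷ W = z • (f ▷ W)
  dag_add : ∀ {a b : B} {X Y : a ⟶ b} (f g : X ⟶ Y), dag (f + g) = dag f + dag g
  dag_smul : ∀ {a b : B} {X Y : a ⟶ b} (z : ℂ) (f : X ⟶ Y),
    dag (z • f) = (starRingEnd ℂ z) • dag f
  norm_comp_le : ∀ {a b : B} {X Y Z : a ⟶ b} (f : X ⟶ Y) (g : Y ⟶ Z), ‖f ≫ g‖ ≤ ‖f‖ * ‖g‖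
  norm_comp_dag : ∀ {a b : B} {X Y : a ⟶ b} (f : X ⟶ Y), ‖f ≫ dag f‖ = ‖f‖ ^ 2
  /-- `f† ∘ f` is a positive element of the C*-algebra `End(X)` -/
  comp_dag_pos : ∀ {a b : B} {X Y : a ⟶ b} (f : X ⟶ Y), ∃ h : X ⟶ X, f ≫ dag f = h ≫ dag h


variable {B : Type u} [Bicategory.{w, v} B] [CStarBicategory B]

attribute [reducible] CStarBicategory.homNormedAddCommGroup CStarBicategory.homNormedSpace

attribute [instance] CStarBicategory.homNormedAddCommGroup CStarBicategory.homNormedSpace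
  CStarBicategory.homComplete

open CStarBicategory

/-! ### The C*-algebras of endomorphisms -/

instance homPreadditive (a b : B) : Preadditive (a ⟶ b) where
  homGroup _ _ := inferInstance
  add_comp _ _ _ f g h := CStarBicategory.add_comp f g h
  comp_add _ _ _ f g h := CStarBicategory.comp_add f g h

instance homLinear (a b : B) : Linear ℂ (a ⟶ b) where
  homModule _ _ := inferInstance
  smul_comp _ _ _ c f g := CStarBicategory.smul_comp c f g
  comp_smul _ _ _ f c g := CStarBicategory.comp_smul f c g

/-- `End(X)` is a C*-algebra, with product `f * g = f ∘ g` and involution the dagger. -/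
instance endCStarAlgebra {a b : B} (X : a ⟶ b) : CStarAlgebra (End X) where
  __ := (inferInstance : Ring (End X))
  __ := (inferInstance : Algebra ℂ (End X))
  __ := (homNormedAddCommGroup X X : NormedAddCommGroup (X ⟶ X))
  norm_mul_le f g := by
    have := norm_comp_le (B := B) (X := X) (Y := X) (Z := X) g f
    rw [mul_comm] at this
    exact this
  norm_smul_le c f := (homNormedSpace X X).norm_smul_le c f
  star f := dag (X := X) (Y := X) f
  star_involutive f := dag_dag (X := X) (Y := X) f
  star_mul f g := dag_comp (X := X) (Y := X) (Z := X) g f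
  star_add f g := dag_add (X := X) (Y := X) f g
  star_smul c f := dag_smul (X := X) (Y := X) c f
  norm_mul_self_le f := by
    have h := norm_comp_dag (X := X) (Y := X) f
    rw [pow_two] at h
    exact h.symm.le
  complete := (homComplete X X).complete

/-! ### Notions for 2-morphisms in a dagger 2-category -/

section TwoMorphisms

variable {a b : B} {X Y : a ⟶ b}

/-- `f† ∘ f = id`. -/
def IsIsometry (f : X ⟶ Y) : Prop := f ≫ dag f = 𝟙 X

/-- `f† ∘ f = id` and `f ∘ f† = id`. -/
def IsUnitary (f : X ⟶ Y) : Prop := f ≫ dag f = 𝟙 X ∧ dag f ≫ f = 𝟙 Y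

/-- `f = g† ∘ g` for some 2-morphism `g : X → X'`. -/
def IsPositive (f : X ⟶ X) : Prop := ∃ (X' : a ⟶ b) (g : X ⟶ X'), f = g ≫ dag g

end TwoMorphisms

/-! ### Presemisimple C*-2-categories -/

/-- A zero 1-morphism, i.e. a zero object of a Hom-category. -/
def IsZeroHom {a b : B} (X : a ⟶ b) : Prop := Subsingleton (X ⟶ X)

/-- `Z` is a (dagger) direct sum of the finite family `X i` of 1-morphisms. -/
def IsHomDirectSum {a b : B} {n : ℕ} (X : Fin n → (a ⟶ b)) (Z : a ⟶ b) : Prop :=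
  ∃ i : ∀ k, X k ⟶ Z, (∀ k, IsIsometry (i k)) ∧ ∑ k, dag (i k) ≫ i k = 𝟙 Z

/-- The Hom-categories are semisimple: they have a zero object and pairwise direct sums, dagger
idempotents split, and endomorphism algebras are finite-dimensional. -/
structure IsLocallySemisimple (B : Type u) [Bicategory.{w, v} B] [CStarBicategory B] : Prop where
  exists_zero : ∀ a b : B, ∃ X : a ⟶ b, IsZeroHom X
  exists_sum : ∀ {a b : B} (X₁ X₂ : a ⟶ b), ∃ Z : a ⟶ b, IsHomDirectSum ![X₁, X₂] Z
  split : ∀ {a b : B} {X : a ⟶ b} (p : X ⟶ X), dag p = p → p ≫ p = p →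
    ∃ (V : a ⟶ b) (i : V ⟶ X), IsIsometry i ∧ p = dag i ≫ i
  finite : ∀ {a b : B} (X : a ⟶ b), FiniteDimensional ℂ (X ⟶ X)

/-- A zero object `r`: the category `End(r)` is terminal (up to equivalence). -/
def IsZeroObject (r : B) : Prop := ∀ X Y : r ⟶ r, Subsingleton (X ⟶ Y)

/-- `R` is a direct sum of the finite family of objects `r i`, with inclusions `ι i : r i ⟶ R`
and projections `π i : R ⟶ r i`. -/
def IsObjectDirectSum {n : ℕ} (r : Fin n → B) (R : B) : Prop :=
  ∃ (ι : ∀ i, r i ⟶ R) (π : ∀ i, R ⟶ r i),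
    (∀ i, ∃ e : ι i ≫ π i ⟶ 𝟙 (r i), IsUnitary e) ∧
    (∀ i j, i ≠ j → IsZeroHom (ι i ≫ π j)) ∧
    IsHomDirectSum (fun i => π i ≫ ι i) (𝟙 R)

/-- An object with simple identity, i.e. `End(id_r) ≅ ℂ`. -/
def IsSimpleObject (r : B) : Prop := Module.finrank ℂ (𝟙 r ⟶ 𝟙 r) = 1

/-- A presemisimple C*-2-category.  A right dual `[X', η, ε]` of `X : r ⟶ s` has
`η : id_s → X' ⊗ X` and `ε : X ⊗ X' → id_r`; in Mathlib's convention this is an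
adjunction `Adjunction X' X`. -/
structure IsPresemisimple (B : Type u) [Bicategory.{w, v} B] [CStarBicategory B] : Prop
    extends IsLocallySemisimple B where
  exists_zeroObject : ∃ r : B, IsZeroObject r
  exists_objectSum : ∀ r₁ r₂ : B, ∃ R : B, IsObjectDirectSum ![r₁, r₂] R
  rigid : ∀ {r s : B} (X : r ⟶ s), ∃ X' : s ⟶ r, Nonempty (Bicategory.Adjunction X' X)
  sum_of_simples : ∀ R : B, ∃ (n : ℕ) (r : Fin n → B),
    (∀ i, IsSimpleObject (r i)) ∧ IsObjectDirectSum r R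

/-! ### Standard duals and separable 1-morphisms -/

/-- The canonical trace on the commutative C*-algebra `End(id_r)`, mapping each minimal
projection to `1`: the trace of the multiplication operator `b ↦ b ∘ a` on `End(id_r)`
(on `ℂⁿ`, this is the sum of the coordinates of `a`). -/
def canTrace {r : B} (a : 𝟙 r ⟶ 𝟙 r) : ℂ :=
  LinearMap.trace ℂ (𝟙 r ⟶ 𝟙 r) (Linear.leftComp ℂ (𝟙 r) a)

/-- `canTrace` maps a minimal idempotent `p` (one with `End(id_r) ∘ p = ℂ p`) to `1`. -/
theorem canTrace_minimal {r : B} [FiniteDimensional ℂ (𝟙 r ⟶ 𝟙 r)] (p : 𝟙 r ⟶ 𝟙 r)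
    (hp : p ≫ p = p) (h0 : p ≠ 0) (hm : ∀ b, ∃ c : ℂ, p ≫ b = c • p) : canTrace p = 1 := by
  choose c hc using hm
  have hi : IsIdempotentElem (Linear.leftComp ℂ (𝟙 r) p) := by
    ext b
    simp [← Category.assoc, hp]
  have hr : LinearMap.range (Linear.leftComp ℂ (𝟙 r) p) = Submodule.span ℂ {p} := by
    ext x
    simp only [LinearMap.mem_range, Submodule.mem_span_singleton]
    constructor
    · rintro ⟨b, rfl⟩
      exact ⟨c b, (hc b).symm⟩
    · rintro ⟨z, rfl⟩
      exact ⟨z • p, by simp [hp]⟩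
  rw [canTrace, (LinearMap.IsIdempotentElem.isProj_range _ hi).trace, hr,
    finrank_span_singleton h0]
  simp

/-- The condition `φ_X = ψ_X` for a cup `η = coev` and a cap `ε = ev`, where
`φ_X(T) = Tr_s[η† ∘ (id ⊗ T) ∘ η]` and `ψ_X(T) = Tr_r[ε ∘ (T ⊗ id) ∘ ε†]`. -/
def IsStandardCupCap {r s : B} (X : r ⟶ s) (X' : s ⟶ r)
    (coev : 𝟙 s ⟶ X' ≫ X) (ev : X ≫ X' ⟶ 𝟙 r) : Prop :=
  ∀ T : X ⟶ X, canTrace (coev ≫ X' ◁ T ≫ dag coev) = canTrace (dag ev ≫ T ▷ X' ≫ ev)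

section Duals

variable {r s : B} {X : r ⟶ s} {X' : s ⟶ r}

/-- The right dual `[X', η, ε]` of `X` is standard. -/
def IsStandardDual (d : Bicategory.Adjunction X' X) : Prop := IsStandardCupCap X X' d.unit d.counit

/-- The left dimension `dim_L(X) = η† ∘ η ∈ End(id_s)`. -/
def dimL (d : Bicategory.Adjunction X' X) : End (𝟙 s) := d.unit ≫ dag d.unit

/-- `X` (with its standard dual) is separable: `dim_L(X)` is invertible. -/
def IsSeparable (d : Bicategory.Adjunction X' X) : Prop := IsUnit (dimL d)

/-- `n_X`, the positive square root of `dim_L(X)` in the C*-algebra `End(id_s)`. -/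
def nRoot (d : Bicategory.Adjunction X' X) : End (𝟙 s) := cfc Real.sqrt (dimL d)

/-- `n_X⁻¹`. -/
def nInv (d : Bicategory.Adjunction X' X) : End (𝟙 s) := Ring.inverse (nRoot d)

end Duals

/-! ### Separable standard Frobenius algebras in `End(r)` -/

/-- The data of an algebra `[A, m, u]` in the tensor category `End(r)`. -/
structure AlgData (r : B) where
  /-- the underlying object -/
  obj : r ⟶ r
  /-- the multiplication -/
  mul : obj ≫ obj ⟶ obj
  /-- the unit -/
  one : 𝟙 r ⟶ obj

namespace AlgData

variable {r : B}

/-- The Frobenius cup `m† ∘ u`. -/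
def cup (A : AlgData r) : 𝟙 r ⟶ A.obj ≫ A.obj := A.one ≫ dag A.mul

/-- The Frobenius cap `u† ∘ m`. -/
def cap (A : AlgData r) : A.obj ≫ A.obj ⟶ 𝟙 r := A.mul ≫ dag A.one

/-- `[A, m, u]` is a separable standard Frobenius algebra (SSFA). -/
structure IsSSFA (A : AlgData r) : Prop where
  assoc : A.mul ▷ A.obj ≫ A.mul = (α_ A.obj A.obj A.obj).hom ≫ A.obj ◁ A.mul ≫ A.mul
  one_mul : A.one ▷ A.obj ≫ A.mul = (λ_ A.obj).hom
  mul_one : A.obj ◁ A.one ≫ A.mul = (ρ_ A.obj).hom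
  frobenius_left :
    dag A.mul ▷ A.obj ≫ (α_ A.obj A.obj A.obj).hom ≫ A.obj ◁ A.mul = A.mul ≫ dag A.mul
  frobenius_right :
    A.obj ◁ dag A.mul ≫ (α_ A.obj A.obj A.obj).inv ≫ A.mul ▷ A.obj = A.mul ≫ dag A.mul
  separable : dag A.mul ≫ A.mul = 𝟙 A.obj
  standard : IsStandardCupCap A.obj A.obj A.cup A.cap

/-- A unitary `*`-isomorphism `f : A → B`: a unitary with `f ∘ m_A = m_B ∘ (f ⊗ f)`,
`f ∘ u_A = u_B` and `f† = (id ⊗ cap_B) ∘ (id ⊗ f ⊗ id) ∘ (cup_A ⊗ id)`. -/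
structure IsUnitaryStarIso (A A' : AlgData r) (f : A.obj ⟶ A'.obj) : Prop where
  unitary : IsUnitary f
  map_mul : A.mul ≫ f = (f ▷ A.obj ≫ A'.obj ◁ f) ≫ A'.mul
  map_one : A.one ≫ f = A'.one
  map_dag : dag f =
    (λ_ A'.obj).inv ≫ A.cup ▷ A'.obj ≫ (α_ A.obj A.obj A'.obj).hom ≫
      A.obj ◁ (f ▷ A'.obj ≫ A'.cap) ≫ (ρ_ A.obj).hom

/-- The CP condition for `f : A → B`: the 2-morphism
`(id_A ⊗ m_B) ∘ (id_A ⊗ f ⊗ id_B) ∘ (m_A† ⊗ id_B) : A ⊗ B → A ⊗ B`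
equals `g† ∘ g` for some `g : A ⊗ B → S` in `End(r)`. -/
def IsCP (A A' : AlgData r) (f : A.obj ⟶ A'.obj) : Prop :=
  IsPositive (dag A.mul ▷ A'.obj ≫ (α_ A.obj A.obj A'.obj).hom ≫ A.obj ◁ (f ▷ A'.obj ≫ A'.mul))

end AlgData

/-- The pair of pants algebra on `X ⊗ X'`, with multiplication
`id_X ⊗ (n_X⁻¹ ∘ η†) ⊗ id_{X'}` and unit `(id_X ⊗ n_X ⊗ id_{X'}) ∘ ε†`. -/
def pairOfPants {r s : B} {X : r ⟶ s} {X' : s ⟶ r} (d : Bicategory.Adjunction X' X) : AlgData r where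
  obj := X ≫ X'
  mul := 𝟙 ((X ≫ X') ≫ X ≫ X') ⊗≫ X ◁ (dag d.unit ≫ nInv d) ▷ X' ⊗≫ 𝟙 (X ≫ X')
  one := dag d.counit ⊗≫ X ◁ nRoot d ▷ X' ⊗≫ 𝟙 (X ≫ X')

/-- A semisimple C*-2-category: presemisimple, and every SSFA in every `End(r)` splits, i.e. is
unitarily `*`-isomorphic to the pair of pants algebra of a separable 1-morphism out of `r`. -/
structure IsSemisimple (B : Type u) [Bicategory.{w, v} B] [CStarBicategory B] : Prop
    extends IsPresemisimple B where
  ssfa_split : ∀ {r : B} (A : AlgData r), A.IsSSFA →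
    ∃ (s : B) (X : r ⟶ s) (X' : s ⟶ r) (d : Bicategory.Adjunction X' X),
      IsStandardDual d ∧ IsSeparable d ∧
      ∃ f : A.obj ⟶ (pairOfPants d).obj, A.IsUnitaryStarIso (pairOfPants d) f

/-- Bending wires: the 2-morphism `f : X ⊗ X' → Y ⊗ Y'` is turned into
`(η_Y† ⊗ id_{Y'} ⊗ id_X) ∘ (id_{Y'} ⊗ f ⊗ id_X) ∘ (id_{Y'} ⊗ id_X ⊗ η_X)`,
an endomorphism of `Y' ⊗ X`. -/
def bend {r s t : B} {X : r ⟶ s} {X' : s ⟶ r} {Y : r ⟶ t} {Y' : t ⟶ r}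
    (dX : Bicategory.Adjunction X' X) (dY : Bicategory.Adjunction Y' Y) (f : X ≫ X' ⟶ Y ≫ Y') : Y' ≫ X ⟶ Y' ≫ X :=
  𝟙 (Y' ≫ X) ⊗≫ Y' ◁ X ◁ dX.unit ⊗≫ Y' ◁ f ▷ X ⊗≫ dag dY.unit ▷ (Y' ≫ X) ⊗≫ 𝟙 (Y' ≫ X)

end CStarTwo

end

/-!
The wire-bending map and the 2-morphism in the CP condition are the two ways of rotating
`f : X ⊗ X' → Y ⊗ Y'` by a quarter turn, the first into `End(Y' ⊗ X)`, the second into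
`End(X' ⊗ Y)`. In Mathlib's terms both are mates (`mateEquiv`), with respect to the given adjunction
`X' ⊣ X` and the dagger `Y ⊣ Y'` of the given adjunction `Y' ⊣ Y`. This makes bending a bijection.

Up to coherence, the 2-morphism in the CP condition is `X ⊗ (n_X⁻¹ ⊗ g ⊗ n_Y⁻¹) ⊗ Y'`, where
`g : X' ⊗ Y → X' ⊗ Y` is the second rotation of `f`. It is positive if and only if `g` is
(`isCP_iff`): the outer strands are removed by partial traces, as the dimensions of `X` and `Y` are
invertible (`isPositive_whisker_iff`), and the scalars `n_X⁻¹`, `n_Y⁻¹` are positive and invertible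
(`IsSeparable.isPositive_scale_nInv_iff`).

The bent `f` is the transpose of `g` along the composite dual of `Y' ⊗ X`, as an iterated mate is a
conjugate. It remains to see that transposition along a standard dual preserves and reflects
positivity (`isPositive_conjugateEquiv_iff`). It is an anti-multiplicative bijection, so it suffices
that it commutes with the dagger, that is, that transposing along the dual and along its dagger give
the same map. This is where standardness enters (`conjugateEquiv_dagAdjunction`): the functional
`T ↦ Tr[η† ∘ (id ⊗ T) ∘ η]` is positive and faithful (`canTrace_comp_dag`), and its two expressions
measure the failure of the two transpositions to agree with opposite signs. Standard duals are
closed under daggers and composition (`IsStandardDual.dagAdjunction`, `IsStandardDual.comp`).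
-/

noncomputable section

namespace CStarTwo

open CStarBicategory

/-! ### Conjugates and scalars in a bicategory -/

section Bicategory

variable {B : Type u} [Bicategory.{w, v} B] {s t : B}

section Mates

variable {V : s ⟶ t} {W : t ⟶ s}

lemma unit_conjugateEquiv (d : V ⊣ W) (m : V ⟶ V) :
    d.unit ≫ V ◁ conjugateEquiv d d m = d.unit ≫ m ▷ W := by
  rw [conjugateEquiv_apply']
  calc
    _ = 𝟙 _ ⊗≫ (d.unit ▷ 𝟙 s ≫ (V ≫ W) ◁ d.unit) ⊗≫ V ◁ W ◁ m ▷ W ⊗≫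
          V ◁ d.counit ▷ W ⊗≫ 𝟙 _ := by bicategory
    _ = 𝟙 _ ⊗≫ d.unit ⊗≫ (d.unit ▷ (V ≫ W) ≫ (V ≫ W) ◁ m ▷ W) ⊗≫
          V ◁ d.counit ▷ W ⊗≫ 𝟙 _ := by
      rw [← whisker_exchange]; bicategory
    _ = 𝟙 _ ⊗≫ d.unit ⊗≫ m ▷ W ⊗≫ leftZigzag d.unit d.counit ▷ W ⊗≫ 𝟙 _ := by
      rw [← whisker_exchange]; bicategory
    _ = _ := by
      rw [d.left_triangle]; bicategory

lemma conjugateEquiv_counit (d : V ⊣ W) (m : V ⟶ V) :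
    conjugateEquiv d d m ▷ V ≫ d.counit = W ◁ m ≫ d.counit := by
  rw [conjugateEquiv_apply']
  calc
    _ = 𝟙 _ ⊗≫ W ◁ d.unit ▷ V ⊗≫ W ◁ m ▷ W ▷ V ⊗≫
          (d.counit ▷ (W ≫ V) ≫ 𝟙 t ◁ d.counit) ⊗≫ 𝟙 _ := by bicategory
    _ = 𝟙 _ ⊗≫ W ◁ d.unit ▷ V ⊗≫ W ◁ (m ▷ (W ≫ V) ≫ V ◁ d.counit) ⊗≫ d.counit ⊗≫ 𝟙 _ := by
      rw [← whisker_exchange]; bicategory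
    _ = 𝟙 _ ⊗≫ W ◁ leftZigzag d.unit d.counit ⊗≫ W ◁ m ⊗≫ d.counit ⊗≫ 𝟙 _ := by
      rw [← whisker_exchange]; bicategory
    _ = _ := by
      rw [d.left_triangle]; bicategory

end Mates

section Scalars

variable {Z : s ⟶ t}

/-- The 2-morphism `a ⊗ f ⊗ b`, for endomorphisms `a` and `b` of identity 1-morphisms. -/
def scale (a : End (𝟙 s)) (f : Z ⟶ Z) (b : End (𝟙 t)) : Z ⟶ Z :=
  (λ_ Z).inv ≫ a ▷ Z ≫ (λ_ Z).hom ≫ f ≫ (ρ_ Z).inv ≫ Z ◁ b ≫ (ρ_ Z).hom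

lemma scale_scale (a a' : End (𝟙 s)) (f : Z ⟶ Z) (b b' : End (𝟙 t)) :
    scale a' (scale a f b) b' = scale (a * a') f (b' * b) := by
  have h : (scale a' (scale a f b) b') = (λ_ Z).inv ≫ (a' ≫ a) ▷ Z ≫ (λ_ Z).hom ≫ f ≫
    (ρ_ Z).inv ≫ Z ◁ (b ≫ b') ≫ (ρ_ Z).hom := by
    simp [scale]
  exact h

lemma scale_one_one (f : Z ⟶ Z) : scale (1 : End (𝟙 s)) f (1 : End (𝟙 t)) = f := by
  have h : (λ_ Z).inv ≫ (𝟙 (𝟙 s)) ▷ Z ≫ (λ_ Z).hom ≫ f ≫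
    (ρ_ Z).inv ≫ Z ◁ 𝟙 (𝟙 t) ≫ (ρ_ Z).hom = f := by
    simp
  exact h

end Scalars

end Bicategory

variable {B : Type u} [Bicategory.{w, v} B] [CStarBicategory B]

/-! ### Daggers of structural 2-morphisms -/

attribute [simp] dag_dag dag_id dag_comp dag_whiskerLeft dag_whiskerRight dag_associator
  dag_leftUnitor dag_rightUnitor

@[simp]
lemma dag_associator_inv {a b c d : B} (X : a ⟶ b) (Y : b ⟶ c) (Z : c ⟶ d) :
    dag (α_ X Y Z).inv = (α_ X Y Z).hom := by
  rw [← dag_associator, dag_dag]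

@[simp]
lemma dag_leftUnitor_inv {a b : B} (X : a ⟶ b) : dag (λ_ X).inv = (λ_ X).hom := by
  rw [← dag_leftUnitor, dag_dag]

@[simp]
lemma dag_rightUnitor_inv {a b : B} (X : a ⟶ b) : dag (ρ_ X).inv = (ρ_ X).hom := by
  rw [← dag_rightUnitor, dag_dag]

lemma dag_zero {a b : B} (X Y : a ⟶ b) : dag (0 : X ⟶ Y) = 0 := by
  simpa using dag_smul (0 : ℂ) (0 : X ⟶ Y)

lemma eq_zero_of_comp_dag_eq_zero {a b : B} {X Y : a ⟶ b} {f : X ⟶ Y} (h : f ≫ dag f = 0) :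
    f = 0 := by
  have := norm_comp_dag f
  rw [h, norm_zero] at this
  exact norm_eq_zero.1 (pow_eq_zero_iff two_ne_zero |>.1 this.symm)

/-! ### Positive 2-morphisms -/

section Positive

variable {a b : B} {X Y : a ⟶ b}

lemma isPositive_comp_dag (f : X ⟶ Y) : IsPositive (f ≫ dag f) := ⟨Y, f, rfl⟩

lemma IsPositive.exists_end {f : X ⟶ X} (hf : IsPositive f) : ∃ h : X ⟶ X, f = h ≫ dag h := by
  obtain ⟨X', g, rfl⟩ := hf
  exact comp_dag_pos g

lemma IsPositive.conj {f : Y ⟶ Y} (hf : IsPositive f) (h : X ⟶ Y) :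
    IsPositive (h ≫ f ≫ dag h) := by
  obtain ⟨Z, g, rfl⟩ := hf
  exact ⟨Z, h ≫ g, by simp⟩

lemma IsPositive.whisker {f : X ⟶ X} (hf : IsPositive f) {c d : B} (V : c ⟶ a) (W : b ⟶ d) :
    IsPositive (V ◁ f ▷ W) := by
  obtain ⟨Z, g, rfl⟩ := hf
  exact ⟨_, V ◁ g ▷ W, by simp⟩

lemma isPositive_zero (X : a ⟶ b) : IsPositive (0 : X ⟶ X) :=
  ⟨X, 0, by rw [dag_zero, Limits.zero_comp]⟩

lemma IsPositive.smul {f : X ⟶ X} (hf : IsPositive f) {c : ℝ} (hc : 0 ≤ c) :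
    IsPositive (c • f) := by
  obtain ⟨Z, g, rfl⟩ := hf
  refine ⟨Z, ((Real.sqrt c : ℝ) : ℂ) • g, ?_⟩
  rw [dag_smul, Complex.conj_ofReal, Linear.smul_comp, Linear.comp_smul, smul_smul,
    ← Complex.ofReal_mul, Real.mul_self_sqrt hc]
  rfl

/-- With `f = g† ∘ g` and `f' = g'† ∘ g'`, the sum is `k† ∘ k` for the 2-morphism `k` into a direct
sum of the two codomains whose components are `g` and `g'`. -/
lemma IsPositive.add (hB : IsLocallySemisimple B) {f f' : X ⟶ X} (hf : IsPositive f)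
    (hf' : IsPositive f') : IsPositive (f + f') := by
  obtain ⟨Z, g, rfl⟩ := hf
  obtain ⟨Z', g', rfl⟩ := hf'
  obtain ⟨S, i₀, i₁, h0, h1, hs⟩ : ∃ (S : a ⟶ b) (i₀ : Z ⟶ S) (i₁ : Z' ⟶ S),
      i₀ ≫ dag i₀ = 𝟙 Z ∧ i₁ ≫ dag i₁ = 𝟙 Z' ∧ dag i₀ ≫ i₀ + dag i₁ ≫ i₁ = 𝟙 S := by
    obtain ⟨S, i, hi, hs⟩ := hB.exists_sum Z Z'
    rw [Fin.sum_univ_two] at hs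
    exact ⟨S, i 0, i 1, hi 0, hi 1, hs⟩
  -- two isometries whose range projections add up to the identity are orthogonal
  have h01 : i₀ ≫ dag i₁ = 0 := by
    have h := congrArg (fun x => (i₀ ≫ x) ≫ dag i₁) hs
    simpa only [Preadditive.comp_add, Preadditive.add_comp, Category.assoc, h1,
      reassoc_of% h0, Category.comp_id, add_eq_left] using h
  have h10 : i₁ ≫ dag i₀ = 0 := by
    rw [← dag_dag (i₁ ≫ dag i₀), dag_comp, dag_dag, h01, dag_zero]
  refine ⟨S, g ≫ i₀ + g' ≫ i₁, ?_⟩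
  simp only [dag_add, dag_comp, Preadditive.comp_add, Preadditive.add_comp, Category.assoc,
    reassoc_of% h0, reassoc_of% h1, reassoc_of% h01, reassoc_of% h10, Limits.zero_comp,
    Limits.comp_zero, add_zero, zero_add]

/-- The positive 2-endomorphisms of a 1-morphism form a convex cone. -/
def positiveCone (hB : IsLocallySemisimple B) (X : a ⟶ b) : PointedCone ℝ (X ⟶ X) where
  carrier := {f | IsPositive f}
  add_mem' := IsPositive.add hB
  zero_mem' := isPositive_zero X
  smul_mem' c _ hf := IsPositive.smul hf c.2

end Positive

/-! ### Faithfulness of the canonical trace -/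

/-- The trace of right multiplication by `a† a` is the sum of its eigenvalues. These are exactly the
points of the spectrum of `a† a`, so they are nonnegative, and all of them vanish only if `a = 0`. -/
lemma trace_mulRight_star_mul_self {A : Type*} [CStarAlgebra A] [FiniteDimensional ℂ A] (a : A) :
    ∃ x : ℝ, 0 ≤ x ∧ LinearMap.trace ℂ A (LinearMap.mulRight ℂ (star a * a)) = x ∧
      (x = 0 → a = 0) := by
  set L : Module.End ℂ A := LinearMap.mulRight ℂ (star a * a) with hL
  have happ (b : A) (z : ℂ) :
      (algebraMap ℂ (Module.End ℂ A) z - L) b = b * (algebraMap ℂ A z - star a * a) := by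
    rw [mul_sub, ← Algebra.commutes, ← Algebra.smul_def]
    rfl
  have hsub : spectrum ℂ (star a * a) ⊆ spectrum ℂ L := by
    intro z hz hu
    refine hz ?_
    rw [spectrum.mem_resolventSet_iff] at hu ⊢
    obtain ⟨c, hc⟩ := ((Module.End.isUnit_iff _).1 hu).2 1
    rw [happ] at hc
    have : IsArtinianRing A := IsArtinianRing.of_finite ℂ A
    exact IsUnit.of_mul_eq_one_right c hc
  have hsup : spectrum ℂ L ⊆ spectrum ℂ (star a * a) := by
    intro z hz hu
    obtain ⟨b, hb⟩ := (Module.End.hasEigenvalue_iff_mem_spectrum.2 hz).exists_hasEigenvector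
    rw [spectrum.mem_resolventSet_iff] at hu
    refine hb.2 (hu.mul_left_eq_zero.1 ?_)
    rw [← happ, LinearMap.sub_apply, hb.apply_eq_smul]
    simp
  have hsa : IsSelfAdjoint (star a * a) := .star_mul_self a
  have hroot : ∀ z ∈ L.charpoly.roots, 0 ≤ z.re ∧ z = (z.re : ℂ) := by
    intro z hz
    have hs := hsup ((Module.End.mem_spectrum_iff_isRoot_charpoly L z).2
      (Polynomial.isRoot_of_mem_roots hz))
    have hre := hsa.mem_spectrum_eq_re hs
    refine ⟨spectrum_star_mul_self_nonneg (b := a) _ ?_, hre⟩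
    rw [hre] at hs
    exact spectrum.of_algebraMap_mem ℂ hs
  have hnn : ∀ x ∈ L.charpoly.roots.map Complex.re, 0 ≤ x := by
    intro x hx
    obtain ⟨z, hz, rfl⟩ := Multiset.mem_map.1 hx
    exact (hroot z hz).1
  refine ⟨(L.charpoly.roots.map Complex.re).sum, Multiset.sum_nonneg hnn, ?_, fun h0 => ?_⟩
  · rw [Module.End.trace_eq_sum_roots_charpoly_of_splits (IsAlgClosed.splits _),
      ← Complex.ofRealHom_eq_coe, map_multiset_sum, Multiset.map_map]
    conv_lhs => rw [← Multiset.map_id L.charpoly.roots]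
    exact congrArg _ (Multiset.map_congr rfl fun z hz => (hroot z hz).2)
  · rw [← CStarRing.star_mul_self_eq_zero_iff]
    refine CFC.eq_zero_of_spectrum_subset_zero (R := ℂ) _ (fun z hz => ?_) hsa.isStarNormal
    have hz' : z ∈ L.charpoly.roots :=
      (Polynomial.mem_roots (LinearMap.charpoly_monic L).ne_zero).2
        ((Module.End.mem_spectrum_iff_isRoot_charpoly L z).1 (hsub hz))
    have := Multiset.all_zero_of_le_zero_le_of_sum_eq_zero hnn h0 _
      (Multiset.mem_map_of_mem Complex.re hz')
    rw [Set.mem_singleton_iff, (hroot z hz').2, this, Complex.ofReal_zero]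

/-- The canonical trace is positive and faithful. -/
lemma canTrace_comp_dag {r : B} [FiniteDimensional ℂ (𝟙 r ⟶ 𝟙 r)] {Z : r ⟶ r} (g : 𝟙 r ⟶ Z) :
    ∃ x : ℝ, 0 ≤ x ∧ canTrace (g ≫ dag g) = x ∧ (x = 0 → g = 0) := by
  obtain ⟨h, hh⟩ := comp_dag_pos g
  have : FiniteDimensional ℂ (End (𝟙 r)) := ‹_›
  obtain ⟨x, hx, htr, hx0⟩ := trace_mulRight_star_mul_self (show End (𝟙 r) from h)
  refine ⟨x, hx, ?_, fun h0 => eq_zero_of_comp_dag_eq_zero ?_⟩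
  · rw [← htr, hh]
    rfl
  · rw [hh, show h = 0 from hx0 h0, Limits.zero_comp]

lemma canTrace_sub {r : B} (a b : 𝟙 r ⟶ 𝟙 r) : canTrace (a - b) = canTrace a - canTrace b := by
  have : Linear.leftComp ℂ (𝟙 r) (a - b) =
      Linear.leftComp ℂ (𝟙 r) a - Linear.leftComp ℂ (𝟙 r) b := by
    ext
    simp
  rw [canTrace, this, map_sub]
  rfl

/-! ### Standard duals and transposition -/

section Transposition

variable {s t : B} {V : s ⟶ t} {W : t ⟶ s}

/-- The dagger of an adjunction `V ⊣ W` is an adjunction `W ⊣ V`. -/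
@[simps]
def dagAdjunction (d : V ⊣ W) : W ⊣ V where
  unit := dag d.counit
  counit := dag d.unit
  left_triangle := by
    have := congrArg dag d.right_triangle
    simpa [leftZigzag, rightZigzag, bicategoricalComp] using this
  right_triangle := by
    have := congrArg dag d.left_triangle
    simpa [leftZigzag, rightZigzag, bicategoricalComp] using this

lemma dag_conjugateEquiv_dagAdjunction (d : V ⊣ W) (k : W ⟶ W) :
    dag (conjugateEquiv (dagAdjunction d) (dagAdjunction d) k) =
      (conjugateEquiv d d).symm (dag k) := by
  rw [conjugateEquiv_apply', conjugateEquiv_symm_apply']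
  simp

lemma eq_zero_of_unit_comp_eq_zero (d : V ⊣ W) {Z : t ⟶ s} {k : W ⟶ Z}
    (h : d.unit ≫ V ◁ k = 0) : k = 0 := by
  have hk : k = 𝟙 _ ⊗≫ W ◁ (d.unit ≫ V ◁ k) ⊗≫ d.counit ▷ Z ⊗≫ 𝟙 _ := by
    symm
    calc
      _ = 𝟙 _ ⊗≫ W ◁ d.unit ⊗≫ ((W ≫ V) ◁ k ≫ d.counit ▷ Z) ⊗≫ 𝟙 _ := by bicategory
      _ = 𝟙 _ ⊗≫ rightZigzag d.unit d.counit ⊗≫ k ⊗≫ 𝟙 _ := by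
        rw [whisker_exchange]; bicategory
      _ = k := by rw [d.right_triangle]; bicategory
  have h0 : W ◁ (0 : 𝟙 s ⟶ V ≫ Z) = 0 := by
    simpa using whiskerLeft_smul W (0 : ℂ) (0 : 𝟙 s ⟶ V ≫ Z)
  rw [hk, h, h0]
  simp [bicategoricalComp]

/-- Transposing along a standard dual and back along its dagger is the identity.  Let `φ` be the
functional `Tr[η† ∘ (id ⊗ -) ∘ η] = Tr[ε ∘ (- ⊗ id) ∘ ε†]` and `θ k` the double transpose of `k`.
Sliding `k` around the loop gives `φ (h ≫ k) = φ (θ k ≫ h)` from the first expression for `φ` and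
`φ (k ≫ h) = φ (h ≫ θ k)` from the second.  Hence `m = θ k - k` satisfies
`φ (m ≫ h) = - φ (h ≫ m)` for all `h`, and `h = m†` yields `m = 0` because `φ` is positive and
faithful. -/
lemma conjugateEquiv_dagAdjunction (hB : IsLocallySemisimple B) (d : V ⊣ W)
    (hd : IsStandardDual d) (k : W ⟶ W) :
    conjugateEquiv d d (conjugateEquiv (dagAdjunction d) (dagAdjunction d) k) = k := by
  have := hB.finite (𝟙 s)
  set n : V ⟶ V := conjugateEquiv (dagAdjunction d) (dagAdjunction d) k with hn
  set θk : W ⟶ W := conjugateEquiv d d n with hθ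
  let φ : (W ⟶ W) → ℂ := fun h => canTrace (d.unit ≫ V ◁ h ≫ dag d.unit)
  have hφψ (h : W ⟶ W) : φ h = canTrace (dag d.counit ≫ h ▷ V ≫ d.counit) := hd h
  have e1 : d.unit ≫ V ◁ θk = d.unit ≫ n ▷ W := unit_conjugateEquiv d n
  have e2 : θk ▷ V ≫ d.counit = W ◁ n ≫ d.counit := conjugateEquiv_counit d n
  have e3 : dag d.counit ≫ W ◁ n = dag d.counit ≫ k ▷ V :=
    unit_conjugateEquiv (dagAdjunction d) k
  have e4 : n ▷ W ≫ dag d.unit = V ◁ k ≫ dag d.unit :=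
    conjugateEquiv_counit (dagAdjunction d) k
  have s1 (h : W ⟶ W) : φ (h ≫ k) = φ (θk ≫ h) := by
    refine congrArg canTrace ?_
    simp only [whiskerLeft_comp, Category.assoc]
    rw [← e4, whisker_exchange_assoc, reassoc_of% e1]
  have s2 (h : W ⟶ W) : φ (k ≫ h) = φ (h ≫ θk) := by
    rw [hφψ, hφψ]
    refine congrArg canTrace ?_
    simp only [comp_whiskerRight, Category.assoc]
    rw [e2, ← reassoc_of% e3, whisker_exchange_assoc]
  have hφsub (f g : W ⟶ W) : φ (f - g) = φ f - φ g := by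
    rw [← canTrace_sub]
    refine congrArg canTrace ?_
    have : V ◁ (f - g) = V ◁ f - V ◁ g := by
      rw [eq_sub_iff_add_eq, ← whiskerLeft_add, sub_add_cancel]
    rw [this, Preadditive.sub_comp, Preadditive.comp_sub]
  have hpos (f : W ⟶ W) : ∃ x : ℝ, 0 ≤ x ∧ φ (f ≫ dag f) = x ∧ (x = 0 → f = 0) := by
    obtain ⟨x, hx, he, h0⟩ := canTrace_comp_dag (d.unit ≫ V ◁ f)
    refine ⟨x, hx, ?_, fun h => eq_zero_of_unit_comp_eq_zero d (h0 h)⟩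
    rw [← he]
    simp [φ]
  have hanti (h : W ⟶ W) : φ ((θk - k) ≫ h) = - φ (h ≫ (θk - k)) := by
    rw [Preadditive.sub_comp, Preadditive.comp_sub, hφsub, hφsub, ← s1, ← s2]
    ring
  obtain ⟨x, hx, hxe, hx0⟩ := hpos (θk - k)
  obtain ⟨y, hy, hye, -⟩ := hpos (dag (θk - k))
  have hxy := hanti (dag (θk - k))
  rw [dag_dag] at hye
  rw [hxe, hye] at hxy
  have hxy' : x = -y := by exact_mod_cast hxy
  exact sub_eq_zero.1 (hx0 (by linarith))

/-- Transposition along a standard dual is a `*`-anti-isomorphism `End(V) → End(W)`. -/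
lemma dag_conjugateEquiv (hB : IsLocallySemisimple B) (d : V ⊣ W) (hd : IsStandardDual d)
    (m : V ⟶ V) : dag (conjugateEquiv d d m) = conjugateEquiv d d (dag m) := by
  obtain ⟨k, rfl⟩ := (conjugateEquiv (dagAdjunction d) (dagAdjunction d)).surjective m
  rw [conjugateEquiv_dagAdjunction hB d hd, dag_conjugateEquiv_dagAdjunction,
    Equiv.apply_symm_apply]

lemma isPositive_conjugateEquiv_iff (hB : IsLocallySemisimple B) (d : V ⊣ W)
    (hd : IsStandardDual d) (m : V ⟶ V) : IsPositive (conjugateEquiv d d m) ↔ IsPositive m := by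
  constructor
  · intro h
    obtain ⟨k, hk⟩ := h.exists_end
    obtain ⟨n, rfl⟩ := (conjugateEquiv d d).surjective k
    rw [dag_conjugateEquiv hB d hd, Bicategory.conjugateEquiv_comp] at hk
    rw [(conjugateEquiv d d).injective hk]
    simpa using isPositive_comp_dag (dag n)
  · intro h
    obtain ⟨n, rfl⟩ := h.exists_end
    rw [← Bicategory.conjugateEquiv_comp d d d, ← dag_conjugateEquiv hB d hd]
    simpa using isPositive_comp_dag (dag (conjugateEquiv d d n))

lemma IsStandardDual.dagAdjunction {d : V ⊣ W} (hd : IsStandardDual d) :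
    IsStandardDual (dagAdjunction d) := by
  intro T
  have h := hd (conjugateEquiv d d T)
  rw [conjugateEquiv_counit, reassoc_of% unit_conjugateEquiv d T] at h
  simpa using h.symm

end Transposition

/-- The composite of standard duals is standard: a full trace may be taken one strand at a time. -/
lemma IsStandardDual.comp {r s t : B} {X' : s ⟶ r} {X : r ⟶ s} {Z : r ⟶ t} {Z' : t ⟶ r}
    {d₁ : X' ⊣ X} {d₂ : Z ⊣ Z'} (h₁ : IsStandardDual d₁) (h₂ : IsStandardDual d₂) :
    IsStandardDual (d₁.comp d₂) := by
  intro T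
  -- the partial traces of `T` over `Z'` and over `X`
  let T₁ : X ⟶ X := 𝟙 _ ⊗≫ d₂.unit ▷ X ⊗≫ Z ◁ T ⊗≫ dag d₂.unit ▷ X ⊗≫ 𝟙 _
  let T₂ : Z' ⟶ Z' := 𝟙 _ ⊗≫ Z' ◁ dag d₁.counit ⊗≫ T ▷ X' ⊗≫ Z' ◁ d₁.counit ⊗≫ 𝟙 _
  have e₁ : (d₁.comp d₂).unit ≫ (X' ≫ Z) ◁ T ≫ dag (d₁.comp d₂).unit =
      d₁.unit ≫ X' ◁ T₁ ≫ dag d₁.unit := by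
    simp [T₁, bicategoricalComp]
  have e₂ : dag d₁.counit ≫ T₁ ▷ X' ≫ d₁.counit = d₂.unit ≫ Z ◁ T₂ ≫ dag d₂.unit := by
    calc
      _ = 𝟙 _ ⊗≫ (𝟙 r ◁ dag d₁.counit ≫ d₂.unit ▷ (X ≫ X')) ⊗≫ Z ◁ T ▷ X' ⊗≫
            (dag d₂.unit ▷ (X ≫ X') ≫ 𝟙 r ◁ d₁.counit) ⊗≫ 𝟙 _ := by
        simp only [T₁]; bicategory
      _ = _ := by
        rw [whisker_exchange d₂.unit (dag d₁.counit), ← whisker_exchange (dag d₂.unit) d₁.counit]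
        simp only [T₂]; bicategory
  have e₃ : dag d₂.counit ≫ T₂ ▷ Z ≫ d₂.counit =
      dag (d₁.comp d₂).counit ≫ T ▷ (X' ≫ Z) ≫ (d₁.comp d₂).counit := by
    simp [T₂, bicategoricalComp]
  rw [e₁, h₁ T₁, e₂, h₂ T₂, e₃]

/-! ### Scaling by positive endomorphisms of identities -/

section Scaling

variable {s t : B} {Z : s ⟶ t}

/-- `c†c ⊗ f ⊗ e†e` is the conjugate of `f` by `c ⊗ id ⊗ e`, since `c` and `e` slide past `f`. -/
lemma IsPositive.scale {f : Z ⟶ Z} (hf : IsPositive f) (c : End (𝟙 s)) (e : End (𝟙 t)) :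
    IsPositive (scale (star c * c) f (star e * e)) := by
  have key (c : 𝟙 s ⟶ 𝟙 s) (e : 𝟙 t ⟶ 𝟙 t) :
      (λ_ Z).inv ≫ (c ≫ dag c) ▷ Z ≫ (λ_ Z).hom ≫ f ≫ (ρ_ Z).inv ≫ Z ◁ (e ≫ dag e) ≫ (ρ_ Z).hom =
      ((λ_ Z).inv ≫ c ▷ Z ≫ (λ_ Z).hom ≫ (ρ_ Z).inv ≫ Z ◁ e ≫ (ρ_ Z).hom) ≫ f ≫
        dag ((λ_ Z).inv ≫ c ▷ Z ≫ (λ_ Z).hom ≫ (ρ_ Z).inv ≫ Z ◁ e ≫ (ρ_ Z).hom) := by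
    simp only [dag_comp, dag_leftUnitor_inv, dag_leftUnitor, dag_rightUnitor_inv, dag_rightUnitor,
      dag_whiskerLeft, dag_whiskerRight]
    calc
      _ = 𝟙 _ ⊗≫ c ▷ Z ⊗≫ (dag c ▷ Z ≫ 𝟙 s ◁ (f ⊗≫ Z ◁ (e ≫ dag e) ⊗≫ 𝟙 Z)) ⊗≫ 𝟙 _ := by
        bicategory
      _ = 𝟙 _ ⊗≫ c ▷ Z ⊗≫ (f ▷ 𝟙 t ≫ Z ◁ e) ⊗≫ Z ◁ dag e ⊗≫ dag c ▷ Z ⊗≫ 𝟙 _ := by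
        rw [← whisker_exchange]; bicategory
      _ = _ := by
        rw [← whisker_exchange f e]; bicategory
  have h := hf.conj ((λ_ Z).inv ≫ c ▷ Z ≫ (λ_ Z).hom ≫ (ρ_ Z).inv ≫ Z ◁ e ≫ (ρ_ Z).hom)
  rw [← key] at h
  exact h

end Scaling

/-! ### The square root of the dimension -/

section Dimension

variable {r s : B} {X : r ⟶ s} {X' : s ⟶ r} (d : X' ⊣ X)

/-- `n_X` is positive: it is the square of the fourth root of `dim_L(X)`. -/
lemma exists_nRoot_eq : ∃ c : End (𝟙 s), nRoot d = star c * c := by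
  have hc : Continuous fun x : ℝ => Real.sqrt (Real.sqrt x) := by fun_prop
  refine ⟨cfc (fun x : ℝ => Real.sqrt (Real.sqrt x)) (dimL d), ?_⟩
  rw [(cfc_predicate _ _ : IsSelfAdjoint _).star_eq,
    ← cfc_mul _ _ _ hc.continuousOn hc.continuousOn, nRoot]
  exact cfc_congr fun x _ => (Real.mul_self_sqrt (Real.sqrt_nonneg x)).symm

lemma nRoot_mul_nRoot : nRoot d * nRoot d = dimL d := by
  obtain ⟨h, hh⟩ := comp_dag_pos d.unit
  have hd : dimL d = star (show End (𝟙 s) from h) * (show End (𝟙 s) from h) := hh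
  have hsa : IsSelfAdjoint (dimL d) := by rw [hd]; exact .star_mul_self _
  rw [nRoot, ← cfc_mul _ _ _ Real.continuous_sqrt.continuousOn Real.continuous_sqrt.continuousOn]
  refine (cfc_congr fun x hx => ?_).trans (cfc_id' ℝ (dimL d))
  rw [hd] at hx
  exact Real.mul_self_sqrt (spectrum_star_mul_self_nonneg x hx)

variable {d}

lemma IsSeparable.isUnit_nRoot (h : IsSeparable d) : IsUnit (nRoot d) := by
  rw [IsSeparable, ← nRoot_mul_nRoot] at h
  exact ((Commute.refl _).isUnit_mul_iff.1 h).1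

lemma star_nInv : star (nInv d) = nInv d := by
  rw [nInv, nRoot, ← Ring.inverse_star, (cfc_predicate _ _ : IsSelfAdjoint _).star_eq]

lemma IsSeparable.exists_nInv_eq (h : IsSeparable d) : ∃ c : End (𝟙 s), nInv d = star c * c := by
  obtain ⟨c, hc⟩ := exists_nRoot_eq d
  -- `n⁻¹ = n⁻¹ n n⁻¹` with `n = c† c`
  refine ⟨c * nInv d, ?_⟩
  rw [star_mul, star_nInv, mul_assoc, ← mul_assoc (star c), ← hc, nInv,
    Ring.mul_inverse_cancel _ h.isUnit_nRoot, mul_one]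

lemma IsSeparable.isPositive_scale_nInv_iff {t : B} {Y : r ⟶ t} {Y' : t ⟶ r} {e : Y' ⊣ Y}
    (hd : IsSeparable d) (he : IsSeparable e) {Z : s ⟶ t} (f : Z ⟶ Z) :
    IsPositive (scale (nInv d) f (nInv e)) ↔ IsPositive f := by
  constructor
  · intro h
    obtain ⟨c, hc⟩ := exists_nRoot_eq d
    obtain ⟨c', hc'⟩ := exists_nRoot_eq e
    have := h.scale c c'
    rwa [← hc, ← hc', scale_scale, nInv, nInv, Ring.inverse_mul_cancel _ hd.isUnit_nRoot,
      Ring.mul_inverse_cancel _ he.isUnit_nRoot, scale_one_one] at this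
  · intro h
    obtain ⟨c, hc⟩ := hd.exists_nInv_eq
    obtain ⟨c', hc'⟩ := he.exists_nInv_eq
    rw [hc, hc']
    exact h.scale c c'

end Dimension

/-! ### Complete positivity and bending -/

section Bend

variable {r s t : B} {X : r ⟶ s} {X' : s ⟶ r} {Y : r ⟶ t} {Y' : t ⟶ r}

lemma dag_pairOfPants_mul (d : X' ⊣ X) :
    dag (pairOfPants d).mul =
      𝟙 (X ≫ X') ⊗≫ X ◁ ((show 𝟙 s ⟶ 𝟙 s from nInv d) ≫ d.unit) ▷ X' ⊗≫
        𝟙 ((X ≫ X') ≫ X ≫ X') := by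
  have h : dag (show 𝟙 s ⟶ 𝟙 s from nInv d) = (show 𝟙 s ⟶ 𝟙 s from nInv d) := star_nInv
  have h' : dag (dag d.unit ≫ nInv d) = (show 𝟙 s ⟶ 𝟙 s from nInv d) ≫ d.unit := by
    rw [dag_comp, dag_dag]
    exact congrArg (· ≫ d.unit) h
  simp only [pairOfPants, bicategoricalComp, dag_comp, dag_whiskerLeft, dag_whiskerRight, h',
    dag_id]
  simp

/-- Tensoring with `X` on the left and `Y'` on the right reflects positivity: the partial traces
recover `dim X ⊗ f ⊗ dim Y` from `X ⊗ f ⊗ Y'`, and the dimensions are invertible. -/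
lemma isPositive_whisker_iff {dX : X' ⊣ X} (sX : IsSeparable dX) {dY : Y' ⊣ Y}
    (sY : IsSeparable dY) {Z : s ⟶ t} (f : Z ⟶ Z) :
    IsPositive (X ◁ f ▷ Y') ↔ IsPositive f := by
  refine ⟨fun h => ?_, fun h => h.whisker X Y'⟩
  -- the nested cups around `Z`, whose two loops evaluate to the dimensions
  let K : Z ⟶ X' ≫ (X ≫ Z ≫ Y') ≫ Y :=
    𝟙 _ ⊗≫ dX.unit ▷ Z ⊗≫ X' ◁ X ◁ Z ◁ dY.unit ⊗≫ 𝟙 _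
  have hK : K ≫ (X' ◁ (X ◁ f ▷ Y') ▷ Y) ≫ dag K =
      (λ_ Z).inv ≫ (dX.unit ≫ dag dX.unit) ▷ Z ≫ (λ_ Z).hom ≫ f ≫
        (ρ_ Z).inv ≫ Z ◁ (dY.unit ≫ dag dY.unit) ≫ (ρ_ Z).hom := by
    have hK' : dag K =
        𝟙 _ ⊗≫ X' ◁ X ◁ Z ◁ dag dY.unit ⊗≫ dag dX.unit ▷ Z ⊗≫ 𝟙 _ := by
      simp [K, bicategoricalComp]
    rw [hK']
    calc
      _ = 𝟙 _ ⊗≫ dX.unit ▷ Z ⊗≫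
            ((X' ≫ X) ◁ (𝟙 Z ⊗≫ Z ◁ dY.unit ⊗≫ f ▷ Y' ▷ Y ⊗≫ Z ◁ dag dY.unit ⊗≫ 𝟙 Z) ≫
              dag dX.unit ▷ Z) ⊗≫ 𝟙 _ := by
        simp only [K]; bicategory
      _ = 𝟙 _ ⊗≫ (dX.unit ≫ dag dX.unit) ▷ Z ⊗≫ (Z ◁ dY.unit ≫ f ▷ (Y' ≫ Y)) ⊗≫
            Z ◁ dag dY.unit ⊗≫ 𝟙 _ := by
        rw [whisker_exchange]; bicategory
      _ = _ := by
        rw [whisker_exchange]; bicategory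
  have h₁ : IsPositive (scale (dimL dX) f (dimL dY)) := by
    have := (h.whisker X' Y).conj K
    rwa [hK] at this
  have h₂ := (sX.isPositive_scale_nInv_iff sY _).2 ((sX.isPositive_scale_nInv_iff sY _).2 h₁)
  have hnX : dimL dX * (nInv dX * nInv dX) = 1 := by
    rw [← nRoot_mul_nRoot, nInv, mul_assoc, Ring.mul_inverse_cancel_left _ _ sX.isUnit_nRoot,
      Ring.mul_inverse_cancel _ sX.isUnit_nRoot]
  have hnY : nInv dY * nInv dY * dimL dY = 1 := by
    rw [← nRoot_mul_nRoot, nInv, mul_assoc, Ring.inverse_mul_cancel_left _ _ sY.isUnit_nRoot,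
      Ring.inverse_mul_cancel _ sY.isUnit_nRoot]
  rwa [scale_scale, scale_scale, hnX, hnY, scale_one_one] at h₂

lemma bend_eq_mateEquiv (dX : X' ⊣ X) (dY : Y' ⊣ Y) (f : X ≫ X' ⟶ Y ≫ Y') :
    bend dX dY f = mateEquiv (dagAdjunction dY) dX f := by
  rw [mateEquiv_apply', bend]
  simp only [dagAdjunction_counit]
  bicategory

/-- The CP condition for `f` is the positivity of `X ⊗ (n⁻¹ ⊗ g ⊗ n⁻¹) ⊗ Y'`, where the
2-endomorphism `g` of `X' ⊗ Y` is the other way of bending the wires of `f`. -/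
lemma isCP_iff {dX : X' ⊣ X} (sX : IsSeparable dX) {dY : Y' ⊣ Y} (sY : IsSeparable dY)
    (f : X ≫ X' ⟶ Y ≫ Y') :
    (pairOfPants dX).IsCP (pairOfPants dY) f ↔
      IsPositive ((mateEquiv dX (dagAdjunction dY)).symm f) := by
  have key (a : 𝟙 s ⟶ 𝟙 s) (b : 𝟙 t ⟶ 𝟙 t) :
      (𝟙 (X ≫ X') ⊗≫ X ◁ (a ≫ dX.unit) ▷ X' ⊗≫ 𝟙 ((X ≫ X') ≫ X ≫ X')) ▷ (Y ≫ Y') ≫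
        (α_ (X ≫ X') (X ≫ X') (Y ≫ Y')).hom ≫
        (X ≫ X') ◁ (f ▷ (Y ≫ Y') ≫
          (𝟙 ((Y ≫ Y') ≫ Y ≫ Y') ⊗≫ Y ◁ (dag dY.unit ≫ b) ▷ Y' ⊗≫ 𝟙 (Y ≫ Y'))) =
      ((α_ X X' (Y ≫ Y')).hom ≫ X ◁ (α_ X' Y Y').inv) ≫
        (X ◁ ((λ_ _).inv ≫ a ▷ (X' ≫ Y) ≫ (λ_ _).hom ≫
          (𝟙 _ ⊗≫ dX.unit ▷ X' ▷ Y ⊗≫ X' ◁ f ▷ Y ⊗≫ X' ◁ Y ◁ dag dY.unit ⊗≫ 𝟙 _) ≫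
          (ρ_ _).inv ≫ (X' ≫ Y) ◁ b ≫ (ρ_ _).hom) ▷ Y') ≫
        X ◁ (α_ X' Y Y').hom ≫ (α_ X X' (Y ≫ Y')).inv := by
    bicategory
  have hCP : dag (pairOfPants dX).mul ▷ (Y ≫ Y') ≫ (α_ (X ≫ X') (X ≫ X') (Y ≫ Y')).hom ≫
      (X ≫ X') ◁ (f ▷ (Y ≫ Y') ≫ (pairOfPants dY).mul) =
    ((α_ X X' (Y ≫ Y')).hom ≫ X ◁ (α_ X' Y Y').inv) ≫
      (X ◁ scale (nInv dX) ((mateEquiv dX (dagAdjunction dY)).symm f) (nInv dY) ▷ Y') ≫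
      X ◁ (α_ X' Y Y').hom ≫ (α_ X X' (Y ≫ Y')).inv := by
    rw [dag_pairOfPants_mul, mateEquiv_symm_apply']
    exact key (nInv dX) (nInv dY)
  rw [← sX.isPositive_scale_nInv_iff sY, ← isPositive_whisker_iff sX sY]
  set g := X ◁ scale (nInv dX) ((mateEquiv dX (dagAdjunction dY)).symm f) (nInv dY) ▷ Y'
  have hiff : (pairOfPants dX).IsCP (pairOfPants dY) f ↔
      IsPositive (((α_ X X' (Y ≫ Y')).hom ≫ X ◁ (α_ X' Y Y').inv) ≫ g ≫
        X ◁ (α_ X' Y Y').hom ≫ (α_ X X' (Y ≫ Y')).inv) := by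
    rw [← hCP]
    rfl
  rw [hiff]
  constructor
  · intro h
    have := h.conj (X ◁ (α_ X' Y Y').hom ≫ (α_ X X' (Y ≫ Y')).inv)
    simpa using this
  · intro h
    have := h.conj ((α_ X X' (Y ≫ Y')).hom ≫ X ◁ (α_ X' Y Y').inv)
    simpa using this

/-- By `iterated_mateEquiv_conjugateEquiv` the two ways of bending the wires of `f` are transposes
of each other, along the standard dual of `Y' ⊗ X` composed from those of `Y'` and `X`. -/
lemma isCP_iff_isPositive_bend (hB : IsLocallySemisimple B)
    {dX : X' ⊣ X} (hX : IsStandardDual dX) (sX : IsSeparable dX)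
    {dY : Y' ⊣ Y} (hY : IsStandardDual dY) (sY : IsSeparable dY) (f : X ≫ X' ⟶ Y ≫ Y') :
    (pairOfPants dX).IsCP (pairOfPants dY) f ↔ IsPositive (bend dX dY f) := by
  rw [isCP_iff sX sY, bend_eq_mateEquiv,
    ← isPositive_conjugateEquiv_iff hB _ (hX.comp hY.dagAdjunction),
    ← Bicategory.iterated_mateEquiv_conjugateEquiv, Equiv.apply_symm_apply]

/-- Bending wires as a linear equivalence. -/
def bendEquiv (dX : X' ⊣ X) (dY : Y' ⊣ Y) : (X ≫ X' ⟶ Y ≫ Y') ≃ₗ[ℂ] (Y' ≫ X ⟶ Y' ≫ X) where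
  __ := mateEquiv (dagAdjunction dY) dX
  map_add' f g := by
    change mateEquiv (dagAdjunction dY) dX (f + g) = mateEquiv _ _ f + mateEquiv _ _ g
    simp [mateEquiv_apply', bicategoricalComp, whiskerLeft_add, add_whiskerRight]
  map_smul' c f := by
    change mateEquiv (dagAdjunction dY) dX (c • f) = c • mateEquiv _ _ f
    simp [mateEquiv_apply', bicategoricalComp, whiskerLeft_smul, smul_whiskerRight]

lemma bendEquiv_apply (dX : X' ⊣ X) (dY : Y' ⊣ Y) (f : X ≫ X' ⟶ Y ≫ Y') :
    bendEquiv dX dY f = bend dX dY f :=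
  (bend_eq_mateEquiv dX dY f).symm

end Bend

end CStarTwo

end

theorem mainTheorem4 {B : Type u} [Bicategory.{w, v} B] [CStarTwo.CStarBicategory B]
    (hB : CStarTwo.IsSemisimple B) {r s t : B}
    {X : r ⟶ s} {X' : s ⟶ r} (dX : Bicategory.Adjunction X' X)
    (hX : CStarTwo.IsStandardDual dX) (sX : CStarTwo.IsSeparable dX)
    {Y : r ⟶ t} {Y' : t ⟶ r} (dY : Bicategory.Adjunction Y' Y)
    (hY : CStarTwo.IsStandardDual dY) (sY : CStarTwo.IsSeparable dY) :
    ∃ (CP : PointedCone ℝ (X ≫ X' ⟶ Y ≫ Y')) (Pos : PointedCone ℝ (Y' ≫ X ⟶ Y' ≫ X)),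
      (CP : Set (X ≫ X' ⟶ Y ≫ Y')) =
        {f | (CStarTwo.pairOfPants dX).IsCP (CStarTwo.pairOfPants dY) f} ∧
      (Pos : Set (Y' ≫ X ⟶ Y' ≫ X)) = {g | CStarTwo.IsPositive g} ∧
      ∃ e : CP ≃ₗ[{c : ℝ // 0 ≤ c}] Pos,
        ∀ f : CP, (e f : Y' ≫ X ⟶ Y' ≫ X) = CStarTwo.bend dX dY f := by
  have hB' := hB.toIsPresemisimple.toIsLocallySemisimple
  let Pos := CStarTwo.positiveCone hB' (Y' ≫ X)
  let e := (CStarTwo.bendEquiv dX dY).restrictScalars {c : ℝ // 0 ≤ c}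
  refine ⟨Submodule.comap e.toLinearMap Pos, Pos, ?_, rfl, e.ofSubmodule' Pos,
    fun f => CStarTwo.bendEquiv_apply dX dY f⟩
  ext f
  refine Iff.trans ?_ (CStarTwo.isCP_iff_isPositive_bend hB' hX sX hY sY f).symm
  rw [← CStarTwo.bendEquiv_apply]
  rfl
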